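/- Let $(\mathsf Y,\mathcal Y)$ and $(\mathsf U,\mathcal U)$ be measurable spaces, $\pi^*$ a probability measure on $\mathsf Y$, and let $R$, $S$, $T$ be Markov transition kernels from $\mathsf Y$ to $\mathsf U$, from $\mathsf Y\times\mathsf U$ to $\mathsf Y$, and from $\mathsf Y\times\mathsf U\times\mathsf Y$ to $\mathsf U$, respectively. Put $\pi(dy\times du)=\pi^*(dy)R(y,du)$ and $$\mu(dy\times du\times d\hat y\times d\hat u)=\pi^*(dy)R(y,du)S(y,u;d\hat y)T(y,u,\hat y;d\hat u),$$ and let $\nu(dy\times du\times d\hat y\times d\hat u)=\pi^*(d\hat y)R(\hat y,d\hat u)S(\hat y,\hat u;dy)T(\hat y,\hat u,y;du)$ be the image of $\mu$ under $(y,u,\hat y,\hat u)\mapsto(\hat y,\hat u,y,u)$. Let $\alpha:(\mathsf Y\times\mathsf U)^2\to[0,1]$ be a measurable function such that one of the following holds. (a) $\pi^*$ and all $S(y,u;\cdot)$ have (jointly measurable) densities $\pi^*(\cdot)$ and $s(y,u;\cdot)$ with respect to one s-finite (for instance, $\sigma$-finite) measure on $\mathsf Y$, all $R(y,\cdot)$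 and $T(y,u,\hat y;\cdot)$ have (jointly measurable) densities $r(y,\cdot)$ and $t(y,u,\hat y;\cdot)$ with respect to one s-finite measure on $\mathsf U$, and for $\mu$-almost all $(y,u,\hat y,\hat u)$ $$\alpha(y,u,\hat y,\hat u)=1\wedge\frac{\pi^*(\hat y)\,r(\hat y,\hat u)\,s(\hat y,\hat u;y)\,t(\hat y,\hat u,y;u)}{\pi^*(y)\,r(y,u)\,s(y,u;\hat y)\,t(y,u,\hat y;\hat u)}.$$ (b) $\alpha=1\wedge\frac{d\nu}{d\mu}$ $\mu$-almost everywhere, where $\frac{d\nu}{d\mu}$ is the Radon--Nikodym derivative (of the $\mu$-absolutely continuous part of $\nu$ if $\nu\not\ll\mu$). Let $\{(Y^{(1)}_k,U^{(1)}_k);k\in\mathbb N\}$ be generated by the freeze algorithm: it is a Markov chain with $(Y^{(1)}_0,U^{(1)}_0)\sim\pi$ in which, given $(Y^{(1)}_k,U^{(1)}_k)=(y,u)$, one draws $\hat y\sim S(y,u;\cdot)$, then $\hat u\sim T(y,u,\hat y;\cdot)$, and sets $(Y^{(1)}_{k+1},U^{(1)}_{k+1})=(\hat y,\hat u)$ with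 probability $\alpha(y,u,\hat y,\hat u)$ and $(Y^{(1)}_{k+1},U^{(1)}_{k+1})=(y,u)$ otherwise. Let $\{Y^{(2)}_k;k\in\mathbb N\}$ be generated by the systematic refreshment algorithm: it is a Markov chain with $Y^{(2)}_0\sim\pi^*$ in which, given $Y^{(2)}_k=y$, one draws $u\sim R(y,\cdot)$, then $\hat y\sim S(y,u;\cdot)$, then $\hat u\sim T(y,u,\hat y;\cdot)$, and sets $Y^{(2)}_{k+1}=\hat y$ with probability $\alpha(y,u,\hat y,\hat u)$ and $Y^{(2)}_{k+1}=y$ otherwise. Then for every $h\in L^2(\pi^*)$ such that $$\sum_{k=1}^\infty\bigl|\operatorname{Cov}\bigl(h(Y^{(i)}_0),h(Y^{(i)}_k)\bigr)\bigr|<\infty\qquad(i\in\{1,2\}),$$ both of the following limits exist in $\mathbb R$ and $$\lim_{n\to\infty}\frac1n\operatorname{Var}\Bigl(\sum_{k=0}^{n-1}h(Y^{(2)}_k)\Bigr)\le\lim_{n\to\infty}\frac1n\operatorname{Var}\Bigl(\sum_{k=0}^{n-1}h(Y^{(1)}_k)\Bigr).$$ -/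

import Mathlib

open MeasureTheory ProbabilityTheory Filter Topology
open scoped ENNReal

namespace DataAugmentation

section Chains

variable {Ω X : Type*} [MeasurableSpace Ω] [MeasurableSpace X]

/-- The σ-algebra `σ(Z 0, …, Z k)` generated by a process up to time `k`. -/
@[reducible]
def pastSigma (Z : ℕ → Ω → X) (k : ℕ) : MeasurableSpace Ω :=
  ⨆ j ∈ Set.Iic k, MeasurableSpace.comap (Z j) inferInstance

/-- The process `Z`, defined on the probability space `(Ω, P)`, is a time-homogeneous Markov chain
with initial distribution `m₀` and transition kernel `K`: the law of `Z 0` is `m₀`, and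
`P(Z (k+1) ∈ A | σ(Z 0, …, Z k)) = K (Z k, A)` almost surely. -/
structure IsMarkovChain (P : Measure Ω) (m₀ : Measure X) (K : Kernel X X)
    (Z : ℕ → Ω → X) : Prop where
  measurable : ∀ k, Measurable (Z k)
  initial : P.map (Z 0) = m₀
  transition : ∀ (k : ℕ) (A : Set X), MeasurableSet A →
    P⟦Z (k + 1) ⁻¹' A | pastSigma Z k⟧ =ᵐ[P] fun ω => (K (Z k ω)).real A

end Chains

section Kernels

variable {Y U : Type*} [MeasurableSpace Y] [MeasurableSpace U]

/-- The accept/reject step: given the current state `x` and the candidate `x'`, move to `x'` with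
probability `α (x, x')` and stay at `x` otherwise. -/
noncomputable def acceptReject {X : Type*} [MeasurableSpace X] (α : X × X → ℝ≥0∞)
    (hα : Measurable α) : Kernel (X × X) X where
  toFun z := α z • Measure.dirac z.2 + (1 - α z) • Measure.dirac z.1
  measurable' := by
    refine Measure.measurable_of_measurable_coe _ fun s hs => ?_
    simp only [Measure.coe_add, Measure.coe_smul, Pi.add_apply, Pi.smul_apply, smul_eq_mul,
      Measure.dirac_apply' _ hs]
    have h1 : Measurable fun z : X × X => s.indicator (1 : X → ℝ≥0∞) z.1 :=
      (measurable_one.indicator hs).comp measurable_fst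
    have h2 : Measurable fun z : X × X => s.indicator (1 : X → ℝ≥0∞) z.2 :=
      (measurable_one.indicator hs).comp measurable_snd
    exact (hα.mul h2).add ((measurable_const.sub hα).mul h1)

/-- One transition `(y, u) ↦ (y', u')` of the freeze algorithm:
draw `ŷ ∼ S(y, u; ·)`, then `û ∼ T(y, u, ŷ; ·)`, and return `(ŷ, û)` with probability
`α ((y, u), (ŷ, û))` and `(y, u)` otherwise. -/
noncomputable def freezeKernel (S : Kernel (Y × U) Y) (T : Kernel ((Y × U) × Y) U)
    (α : (Y × U) × (Y × U) → ℝ≥0∞) (hα : Measurable α) : Kernel (Y × U) (Y × U) :=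
  acceptReject α hα ∘ₖ (Kernel.id ×ₖ (S ⊗ₖ T))

/-- One transition `y ↦ y'` of the systematic refreshment algorithm:
draw `u ∼ R(y, ·)`, `ŷ ∼ S(y, u; ·)` and `û ∼ T(y, u, ŷ; ·)`, and return `ŷ` with probability
`α ((y, u), (ŷ, û))` and `y` otherwise. -/
noncomputable def refreshKernel (R : Kernel Y U) (S : Kernel (Y × U) Y)
    (T : Kernel ((Y × U) × Y) U) (α : (Y × U) × (Y × U) → ℝ≥0∞) (hα : Measurable α) :
    Kernel Y Y :=
  ((acceptReject α hα).map Prod.fst) ∘ₖ (Kernel.id ×ₖ (S ⊗ₖ T)) ∘ₖ (Kernel.id ×ₖ R)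

theorem lintegral_acceptReject {X : Type*} [MeasurableSpace X] (α : X × X → ℝ≥0∞)
    (hα : Measurable α) (z : X × X) {f : X → ℝ≥0∞} (hf : Measurable f) :
    ∫⁻ x, f x ∂(acceptReject α hα z) = α z * f z.2 + (1 - α z) * f z.1 := by
  have : acceptReject α hα z = α z • Measure.dirac z.2 + (1 - α z) • Measure.dirac z.1 := rfl
  rw [this, lintegral_add_measure, lintegral_smul_measure, lintegral_smul_measure,
    lintegral_dirac' _ hf, lintegral_dirac' _ hf, smul_eq_mul, smul_eq_mul]

/-- The freeze transition, spelled out on test functions. -/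
theorem lintegral_freezeKernel (S : Kernel (Y × U) Y) [IsMarkovKernel S]
    (T : Kernel ((Y × U) × Y) U) [IsMarkovKernel T] (α : (Y × U) × (Y × U) → ℝ≥0∞)
    (hα : Measurable α) (y : Y) (u : U) {f : Y × U → ℝ≥0∞} (hf : Measurable f) :
    ∫⁻ x, f x ∂(freezeKernel S T α hα (y, u)) =
      ∫⁻ y', ∫⁻ u', (α ((y, u), (y', u')) * f (y', u') + (1 - α ((y, u), (y', u'))) * f (y, u))
        ∂(T ((y, u), y')) ∂(S (y, u)) := by
  have hm : Measurable fun z : (Y × U) × (Y × U) => α z * f z.2 + (1 - α z) * f z.1 :=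
    (hα.mul (hf.comp measurable_snd)).add
      ((measurable_const.sub hα).mul (hf.comp measurable_fst))
  have hm' : Measurable fun b : Y × U =>
      α ((y, u), b) * f b + (1 - α ((y, u), b)) * f (y, u) :=
    hm.comp (measurable_const.prodMk measurable_id)
  rw [freezeKernel, Kernel.lintegral_comp _ _ _ hf]
  simp_rw [lintegral_acceptReject α hα _ hf]
  rw [Kernel.lintegral_id_prod hm, Kernel.lintegral_compProd _ _ _ hm']

/-- The systematic refreshment transition, spelled out on test functions. -/
theorem lintegral_refreshKernel (R : Kernel Y U) [IsMarkovKernel R]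
    (S : Kernel (Y × U) Y) [IsMarkovKernel S]
    (T : Kernel ((Y × U) × Y) U) [IsMarkovKernel T] (α : (Y × U) × (Y × U) → ℝ≥0∞)
    (hα : Measurable α) (y : Y) {f : Y → ℝ≥0∞} (hf : Measurable f) :
    ∫⁻ x, f x ∂(refreshKernel R S T α hα y) =
      ∫⁻ u, ∫⁻ y', ∫⁻ u', (α ((y, u), (y', u')) * f y' + (1 - α ((y, u), (y', u'))) * f y)
        ∂(T ((y, u), y')) ∂(S (y, u)) ∂(R y) := by
  have hf' : Measurable fun x : Y × U => f x.1 := hf.comp measurable_fst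
  have hk : refreshKernel R S T α hα =
      ((freezeKernel S T α hα).map Prod.fst) ∘ₖ (Kernel.id ×ₖ R) := by
    rw [refreshKernel, freezeKernel, Kernel.map_comp]
  have hm : Measurable fun x : Y × U => ∫⁻ b, f b ∂((freezeKernel S T α hα).map Prod.fst x) :=
    hf.lintegral_kernel
  rw [hk, Kernel.lintegral_comp _ _ _ hf, Kernel.lintegral_id_prod hm]
  refine lintegral_congr fun u => ?_
  rw [Kernel.lintegral_map _ measurable_fst _ hf, lintegral_freezeKernel S T α hα y u hf']

end Kernels

section Acceptance

variable {Y U : Type*} [MeasurableSpace Y] [MeasurableSpace U]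

/-- The joint law `μ(dy du dŷ dû) = π*(dy) R(y, du) S(y, u; dŷ) T(y, u, ŷ; dû)` of the current
state and of the candidate, for a current state distributed according to
`π(dy du) = π*(dy) R(y, du)`. -/
noncomputable def proposalLaw (πs : Measure Y) (R : Kernel Y U) (S : Kernel (Y × U) Y)
    (T : Kernel ((Y × U) × Y) U) : Measure ((Y × U) × (Y × U)) :=
  (πs ⊗ₘ R) ⊗ₘ (S ⊗ₖ T)

/-- The dominated case: the measure `π*` and all `S(y, u; ·)` have densities `p`, `s` with respect to one
measure on `Y`, all `R(y, ·)` and `T(y, u, ŷ; ·)` have densities `r`, `t` with respect to one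
measure on `U`, and
`α = 1 ∧ (p(ŷ) r(ŷ, û) s(ŷ, û; y) t(ŷ, û, y; u)) / (p(y) r(y, u) s(y, u; ŷ) t(y, u, ŷ; û))`.
The identity is asked for almost everywhere for the law of (current state, candidate); the
denominator is almost everywhere positive and finite for this law. -/
def IsDensityRatio (πs : Measure Y) (R : Kernel Y U) (S : Kernel (Y × U) Y)
    (T : Kernel ((Y × U) × Y) U) (α : (Y × U) × (Y × U) → ℝ≥0∞) : Prop :=
  ∃ (lY : Measure Y) (lU : Measure U) (p : Y → ℝ≥0∞) (r : Y × U → ℝ≥0∞)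
    (s : (Y × U) × Y → ℝ≥0∞) (t : ((Y × U) × Y) × U → ℝ≥0∞),
    SFinite lY ∧ SFinite lU ∧ Measurable p ∧ Measurable r ∧ Measurable s ∧ Measurable t ∧
    πs = lY.withDensity p ∧
    (∀ y, R y = lU.withDensity fun u => r (y, u)) ∧
    (∀ x, S x = lY.withDensity fun y' => s (x, y')) ∧
    (∀ w, T w = lU.withDensity fun u' => t (w, u')) ∧
    ∀ᵐ z ∂(proposalLaw πs R S T), ∀ y u y' u', z = ((y, u), (y', u')) →
      α z = min 1 ((p y' * r (y', u') * s ((y', u'), y) * t (((y', u'), y), u)) /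
        (p y * r (y, u) * s ((y, u), y') * t (((y, u), y'), u')))

/-- The general case: `α = 1 ∧ dν/dμ` almost everywhere with respect to `μ`, where `μ` is the law
of (current state, candidate) and `ν` is the image of `μ` under exchange of these two, that is
`ν(dy du dŷ dû) = π*(dŷ) R(ŷ, dû) S(ŷ, û; dy) T(ŷ, û, y; du)`. -/
def IsRadonNikodymRatio (πs : Measure Y) (R : Kernel Y U) (S : Kernel (Y × U) Y)
    (T : Kernel ((Y × U) × Y) U) (α : (Y × U) × (Y × U) → ℝ≥0∞) : Prop :=
  ∀ᵐ z ∂(proposalLaw πs R S T),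
    α z = min 1 (((proposalLaw πs R S T).map Prod.swap).rnDeriv (proposalLaw πs R S T) z)

/-- `α` is a Metropolis–Hastings acceptance probability for the target
`π(dy du) = π*(dy) R(y, du)` and the proposal `S(y, u; dŷ) T(y, u, ŷ; dû)`. -/
def IsAcceptanceProbability (πs : Measure Y) (R : Kernel Y U) (S : Kernel (Y × U) Y)
    (T : Kernel ((Y × U) × Y) U) (α : (Y × U) × (Y × U) → ℝ≥0∞) : Prop :=
  (∀ z, α z ≤ 1) ∧ (IsDensityRatio πs R S T α ∨ IsRadonNikodymRatio πs R S T α)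

end Acceptance

end DataAugmentation

/-! Let `P` be the freeze operator on L²(π), `Q` the refreshment operator on L²(π*), and `J f (y, u)
= f y`, an isometry of L²(π*) into L²(π). The acceptance probability makes `P` a self-adjoint
contraction (`isReversible_freezeKernel`), and drawing `u` afresh from `R` means `Q = J* P J`
(`inner_transitionOperator_refreshKernel`).

Both chains are stationary, so for centred `h` the lag-k autocovariances are ⟨h, Qᵏ h⟩ and ⟨Jh, Pᵏ
Jh⟩. Each asymptotic variance is twice the sum of its series minus the lag-0 term, and the lag-0
terms agree since `J` is isometric. It remains to compare the two sums.

For r < 1 the damped sums are the resolvent forms ⟨h, f⟩ and ⟨Jh, g⟩, with f = (1 - rQ)⁻¹h and g =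
(1 - rP)⁻¹Jh. Positivity of 1 - rP at x = Jf - g gives 0 ≤ ⟨x, (1 - rP)x⟩ = ⟨Jh, g⟩ - ⟨h, f⟩. Abel's
theorem lets r ↑ 1. -/

namespace DataAugmentation

/-! ### Resolvents of compressed self-adjoint contractions -/

section Hilbert

theorem norm_pow_apply_le {E : Type*} [NormedAddCommGroup E] [NormedSpace ℝ E]
    {P : E →L[ℝ] E} (hP : ‖P‖ ≤ 1) (h : E) (k : ℕ) :
    ‖(P ^ k) h‖ ≤ ‖h‖ := by
  induction k with
  | zero => simp
  | succ k ih =>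
    rw [pow_succ', mul_apply_eq_comp]
    exact ((P.le_of_opNorm_le hP _).trans_eq (one_mul _)).trans ih

variable {E F : Type*} [NormedAddCommGroup E] [InnerProductSpace ℝ E] [CompleteSpace E]
  [NormedAddCommGroup F] [InnerProductSpace ℝ F] [CompleteSpace F]

/-- Neumann series for (1 - rP)⁻¹h: the series links it to autocovariances, the equation serves the
quadratic-form computation. -/
theorem exists_hasSum_geometric_orbit {P : E →L[ℝ] E} (hP : ‖P‖ ≤ 1) {r : ℝ} (h0 : 0 ≤ r)
    (h1 : r < 1) (h : E) :
    ∃ g, HasSum (fun k : ℕ => r ^ k • (P ^ k) h) g ∧ g - r • P g = h := by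
  have hs : Summable fun k : ℕ => r ^ k • (P ^ k) h := by
    refine Summable.of_norm_bounded ((summable_geometric_of_lt_one h0 h1).mul_right ‖h‖) ?_
    intro k
    rw [norm_smul, norm_pow, Real.norm_of_nonneg h0]
    gcongr
    exact norm_pow_apply_le hP h k
  refine ⟨_, hs.hasSum, ?_⟩
  have h2 : HasSum (fun k : ℕ => r ^ (k + 1) • (P ^ (k + 1)) h)
      (r • P (∑' k : ℕ, r ^ k • (P ^ k) h)) := by
    convert (P.hasSum hs.hasSum).const_smul r using 2 with k
    rw [map_smul, smul_smul, ← pow_succ', pow_succ' P, mul_apply_eq_comp]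
  rw [sub_eq_iff_eq_add, ← h2.tsum_eq, hs.tsum_eq_zero_add]
  simp

/-- Compressing a self-adjoint contraction decreases the quadratic form of its resolvent. -/
theorem tsum_inner_pow_compression_le (J : F →L[ℝ] E) (hJ : ∀ f g, inner ℝ (J f) (J g) = inner ℝ f g)
    {P : E →L[ℝ] E} {Q : F →L[ℝ] F} (hP : ‖P‖ ≤ 1) (hQ : ‖Q‖ ≤ 1)
    (hPs : ∀ f g, inner ℝ (P f) g = inner ℝ f (P g))
    (hQP : ∀ f g, inner ℝ f (Q g) = inner ℝ (J f) (P (J g))) {r : ℝ} (h0 : 0 ≤ r) (h1 : r < 1)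
    (h : F) :
    ∑' k : ℕ, inner ℝ h ((Q ^ k) h) * r ^ k ≤ ∑' k : ℕ, inner ℝ (J h) ((P ^ k) (J h)) * r ^ k := by
  obtain ⟨f, hf, hf'⟩ := exists_hasSum_geometric_orbit hQ h0 h1 h
  obtain ⟨g, hg, hg'⟩ := exists_hasSum_geometric_orbit hP h0 h1 (J h)
  have e1 : ∑' k : ℕ, inner ℝ h ((Q ^ k) h) * r ^ k = inner ℝ h f := by
    refine HasSum.tsum_eq ?_
    have := (innerSL ℝ h).hasSum hf
    simpa [inner_smul_right, mul_comm] using this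
  have e2 : ∑' k : ℕ, inner ℝ (J h) ((P ^ k) (J h)) * r ^ k = inner ℝ (J h) g := by
    refine HasSum.tsum_eq ?_
    have := (innerSL ℝ (J h)).hasSum hg
    simpa [inner_smul_right, mul_comm] using this
  rw [e1, e2]
  -- The error in replacing the full resolvent by the compressed one; its energy is exactly the gap
  -- to be signed.
  set x := J f - g
  have hx : 0 ≤ inner ℝ x (x - r • P x) := by
    rw [inner_sub_right, inner_smul_right, real_inner_self_eq_norm_sq]
    have hb : inner ℝ x (P x) ≤ ‖x‖ ^ 2 := by
      refine (real_inner_le_norm _ _).trans ?_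
      rw [sq]
      gcongr
      exact (P.le_of_opNorm_le hP _).trans_eq (one_mul _)
    nlinarith [sq_nonneg ‖x‖]
  have h4 : x - r • P x = (J f - r • P (J f)) - J h := by
    rw [← hg']
    simp only [x, map_sub, smul_sub]
    abel
  have h5 : inner ℝ (J f) (J f - r • P (J f)) = inner ℝ h f := by
    rw [inner_sub_right, inner_smul_right, hJ, ← hQP, ← inner_smul_right, ← inner_sub_right, hf',
      real_inner_comm]
  -- Self-adjointness moves 1 - rP onto g, where it produces Jh; the two energy terms then cancel in
  -- ⟨x, (1 - rP)x⟩.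
  have h6 : inner ℝ g (J f - r • P (J f)) = inner ℝ h f := by
    rw [inner_sub_right, inner_smul_right, ← hPs, ← real_inner_smul_left, ← inner_sub_left, hg', hJ]
  rw [h4, inner_sub_right, inner_sub_left, h5, h6, inner_sub_left, hJ, real_inner_comm h f,
    real_inner_comm (J h) g] at hx
  linarith

/-- Abel's limit theorem: summability lets r ↑ 1 in the damped inequality. -/
theorem tsum_autocovariance_compression_le (J : F →L[ℝ] E)
    (hJ : ∀ f g, inner ℝ (J f) (J g) = inner ℝ f g)
    {P : E →L[ℝ] E} {Q : F →L[ℝ] F} (hP : ‖P‖ ≤ 1) (hQ : ‖Q‖ ≤ 1)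
    (hPs : ∀ f g, inner ℝ (P f) g = inner ℝ f (P g))
    (hQP : ∀ f g, inner ℝ f (Q g) = inner ℝ (J f) (P (J g))) (h : F)
    (hsQ : Summable fun k : ℕ => inner ℝ h ((Q ^ k) h))
    (hsP : Summable fun k : ℕ => inner ℝ (J h) ((P ^ k) (J h))) :
    ∑' k : ℕ, inner ℝ h ((Q ^ k) h) ≤ ∑' k : ℕ, inner ℝ (J h) ((P ^ k) (J h)) := by
  refine le_of_tendsto_of_tendsto
    (Real.tendsto_tsum_powerSeries_nhdsWithin_lt hsQ.hasSum.tendsto_sum_nat)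
    (Real.tendsto_tsum_powerSeries_nhdsWithin_lt hsP.hasSum.tendsto_sum_nat) ?_
  filter_upwards [Ioo_mem_nhdsLT (zero_lt_one (α := ℝ))] with r hr
  exact tsum_inner_pow_compression_le J hJ hP hQ hPs hQP hr.1.le hr.2 h

end Hilbert

/-! ### Asymptotic variance of stationary sequences -/

section AsymptoticVariance

variable {Ω : Type*} [MeasurableSpace Ω]

/-- The asymptotic variance of a stationary sequence with summable autocovariances. -/
theorem tendsto_variance_sum_div {P : Measure Ω} [IsProbabilityMeasure P] {X : ℕ → Ω → ℝ}
    (hX : ∀ k, MemLp (X k) 2 P) {c : ℕ → ℝ} (hc : ∀ j k, cov[X j, X (j + k); P] = c k)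
    (hs : Summable c) :
    Tendsto (fun n : ℕ => (1 / (n : ℝ)) * Var[fun ω => ∑ k ∈ Finset.range n, X k ω; P]) atTop
      (𝓝 (2 * ∑' k, c k - c 0)) := by
  set V : ℕ → ℝ := fun n => Var[fun ω => ∑ k ∈ Finset.range n, X k ω; P] with hV
  -- The increments of the variance converge, so `V n / n`, their Cesàro mean, has the same limit.
  have hstep : ∀ n, V (n + 1) - V n = 2 * ∑ k ∈ Finset.range (n + 1), c k - c 0 := by
    intro n
    have hSn : MemLp (fun ω => ∑ k ∈ Finset.range n, X k ω) 2 P :=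
      memLp_finsetSum _ fun k _ => hX k
    have e : V (n + 1) = V n + 2 * cov[fun ω => ∑ k ∈ Finset.range n, X k ω, X n; P]
        + Var[X n; P] := by
      simp only [hV, Finset.sum_range_succ]
      exact variance_fun_add hSn (hX n)
    rw [e, covariance_fun_sum_left' (fun k _ => hX k) (hX n),
      ← covariance_self (hX n).aestronglyMeasurable.aemeasurable,
      show cov[X n, X n; P] = c 0 from hc n 0,
      Finset.sum_range_succ', ← Finset.sum_range_reflect (fun i => c (i + 1))]
    -- The lag n - i is at least 1, hence its form (n - 1 - i) + 1.
    have : ∑ i ∈ Finset.range n, cov[X i, X n; P]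
        = ∑ j ∈ Finset.range n, c (n - 1 - j + 1) := by
      refine Finset.sum_congr rfl fun i hi => ?_
      have hi' := Finset.mem_range.1 hi
      rw [← hc i]
      congr 2
      omega
    rw [this]
    ring
  have hlim : Tendsto (fun n => V (n + 1) - V n) atTop (𝓝 (2 * ∑' k, c k - c 0)) := by
    simp_rw [hstep]
    exact ((((tendsto_add_atTop_iff_nat 1).2 hs.hasSum.tendsto_sum_nat)).const_mul 2).sub_const _
  have hV0 : V 0 = 0 := by
    simp only [hV, Finset.range_zero, Finset.sum_empty]
    exact variance_zero P
  have := hlim.cesaro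
  simp_rw [Finset.sum_range_sub, hV0, sub_zero] at this
  simpa only [one_div] using this

end AsymptoticVariance

/-! ### Detailed balance of the freeze kernel -/

section Reversibility

/-- The accepted flow has density F · (1 ∧ F∘swap / F) = F ∧ F∘swap against a swap-invariant
reference measure, and this is symmetric. Both forms of the acceptance probability reduce to this
case. -/
theorem map_swap_withDensity_of_acceptance {X : Type*} [MeasurableSpace X] {μ m : Measure (X × X)}
    [IsFiniteMeasure μ] (hm : m.map Prod.swap = m) {F : X × X → ℝ≥0∞} (hF : Measurable F)
    (hμ : μ = m.withDensity F) {α : X × X → ℝ≥0∞} (hα : Measurable α)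
    (h : ∀ᵐ z ∂μ, α z = min 1 (F z.swap / F z)) :
    (μ.withDensity α).map Prod.swap = μ.withDensity α := by
  have hfin : ∀ᵐ z ∂m, F z < ∞ := by
    refine ae_lt_top hF ?_
    rw [← setLIntegral_univ, ← withDensity_apply _ .univ, ← hμ]
    exact measure_ne_top _ _
  rw [hμ, ae_withDensity_iff hF] at h
  have e : μ.withDensity α = m.withDensity fun z => min (F z) (F z.swap) := by
    rw [hμ, ← withDensity_mul _ hF hα]
    refine withDensity_congr_ae ?_
    filter_upwards [hfin, h] with z hz1 hz2
    -- Where F vanishes both densities are 0, whatever value α takes; elsewhere F is nonzero and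
    -- finite, so the quotient cancels.
    by_cases h0 : F z = 0
    · simp [h0]
    · rw [Pi.mul_apply, hz2 h0, (show Monotone fun b => F z * b from
        fun _ _ hab => mul_le_mul_right hab (F z)).map_min, mul_one,
        ENNReal.mul_div_cancel h0 hz1.ne]
  rw [e]
  ext s hs
  rw [Measure.map_apply measurable_swap hs, withDensity_apply _ (measurable_swap hs),
    withDensity_apply _ hs]
  have hmp : MeasurePreserving (Prod.swap : X × X → X × X) m m := ⟨measurable_swap, hm⟩
  rw [← hmp.setLIntegral_comp_preimage hs
    (f := fun z => min (F z) (F z.swap)) (hF.min (hF.comp measurable_swap))]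
  refine lintegral_congr fun z => ?_
  simp [min_comm]

/-- Tonelli; iterating it along R, S, T gives the density of the proposal law. -/
theorem compProd_withDensity_eq {X Z : Type*} [MeasurableSpace X] [MeasurableSpace Z]
    {m m' : Measure X} {l : Measure Z} [SFinite m] [SFinite m'] [SFinite l] {κ : Kernel X Z}
    [IsSFiniteKernel κ] {p : X → ℝ≥0∞} {k : X × Z → ℝ≥0∞} (hp : Measurable p) (hk : Measurable k)
    (hm : m' = m.withDensity p) (hκ : ∀ x, κ x = l.withDensity fun z => k (x, z)) :
    m' ⊗ₘ κ = (m.prod l).withDensity fun z => p z.1 * k z := by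
  refine Measure.ext_of_lintegral _ fun f hf => ?_
  have hkx : ∀ x, Measurable fun z => k (x, z) := fun x => hk.comp measurable_prodMk_left
  have hfx : ∀ x, Measurable fun z => f (x, z) := fun x => hf.comp measurable_prodMk_left
  have hpk : Measurable fun z : X × Z => p z.1 * k z := (hp.comp measurable_fst).mul hk
  rw [Measure.lintegral_compProd hf, hm,
    lintegral_withDensity_eq_lintegral_mul _ hp hf.lintegral_kernel_prod_right',
    lintegral_withDensity_eq_lintegral_mul (m.prod l) hpk hf,
    lintegral_prod _ (hpk.mul hf).aemeasurable]
  refine lintegral_congr fun x => ?_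
  rw [Pi.mul_apply, hκ, lintegral_withDensity_eq_lintegral_mul _ (hkx x) (hfx x),
    ← lintegral_const_mul _ ((hkx x).mul (hfx x))]
  refine lintegral_congr fun z => ?_
  simp [mul_assoc]

variable {Y U : Type*} [MeasurableSpace Y] [MeasurableSpace U]

theorem measurable_density {p : Y → ℝ≥0∞} {r : Y × U → ℝ≥0∞} {s : (Y × U) × Y → ℝ≥0∞}
    {t : ((Y × U) × Y) × U → ℝ≥0∞} (hp : Measurable p) (hr : Measurable r) (hs : Measurable s)
    (ht : Measurable t) :
    Measurable fun z : (Y × U) × (Y × U) =>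
      (p z.1.1 * r z.1) * (s (z.1, z.2.1) * t ((z.1, z.2.1), z.2.2)) := by
  have h1 : Measurable fun z : (Y × U) × (Y × U) => s (z.1, z.2.1) := hs.comp (by fun_prop)
  have h2 : Measurable fun z : (Y × U) × (Y × U) => t ((z.1, z.2.1), z.2.2) :=
    ht.comp (by fun_prop)
  exact ((hp.comp measurable_fst.fst).mul (hr.comp measurable_fst)).mul (h1.mul h2)

theorem proposalLaw_eq_withDensity {πs : Measure Y} [IsProbabilityMeasure πs]
    {R : Kernel Y U} [IsMarkovKernel R] {S : Kernel (Y × U) Y} [IsMarkovKernel S]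
    {T : Kernel ((Y × U) × Y) U} [IsMarkovKernel T] {lY : Measure Y} {lU : Measure U} [SFinite lY]
    [SFinite lU] {p : Y → ℝ≥0∞} {r : Y × U → ℝ≥0∞} {s : (Y × U) × Y → ℝ≥0∞}
    {t : ((Y × U) × Y) × U → ℝ≥0∞} (hp : Measurable p) (hr : Measurable r) (hs : Measurable s)
    (ht : Measurable t) (hπ : πs = lY.withDensity p)
    (hR : ∀ y, R y = lU.withDensity fun u => r (y, u))
    (hS : ∀ x, S x = lY.withDensity fun y' => s (x, y'))
    (hT : ∀ w, T w = lU.withDensity fun u' => t (w, u')) :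
    proposalLaw πs R S T = ((lY.prod lU).prod (lY.prod lU)).withDensity fun z =>
      (p z.1.1 * r z.1) * (s (z.1, z.2.1) * t ((z.1, z.2.1), z.2.2)) := by
  have hpr : πs ⊗ₘ R = (lY.prod lU).withDensity fun x => p x.1 * r x :=
    compProd_withDensity_eq hp hr hπ hR
  have h1 : ∀ x : Y × U, Measurable fun y => s (x, y) := fun x => hs.comp measurable_prodMk_left
  have h2 : ∀ x : Y × U, Measurable fun w : Y × U => t ((x, w.1), w.2) := fun x =>
    ht.comp ((measurable_const.prodMk measurable_fst).prodMk measurable_snd)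
  have hst : ∀ x, (S ⊗ₖ T) x
      = (lY.prod lU).withDensity fun x' => s (x, x'.1) * t ((x, x'.1), x'.2) := by
    intro x
    rw [Kernel.compProd_apply_eq_compProd_sectR]
    exact compProd_withDensity_eq (p := fun y => s (x, y)) (k := fun w => t ((x, w.1), w.2))
      (h1 x) (h2 x) (hS x) (fun y => hT (x, y))
  have h3 : Measurable fun z : (Y × U) × (Y × U) => s (z.1, z.2.1) * t ((z.1, z.2.1), z.2.2) := by
    refine (hs.comp ?_).mul (ht.comp ?_) <;> fun_prop
  have h4 : Measurable fun x : Y × U => p x.1 * r x := (hp.comp measurable_fst).mul hr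
  have h5 := compProd_withDensity_eq (m := lY.prod lU) (l := lY.prod lU) (κ := S ⊗ₖ T)
    (p := fun x : Y × U => p x.1 * r x)
    (k := fun z : (Y × U) × (Y × U) => s (z.1, z.2.1) * t ((z.1, z.2.1), z.2.2)) h4 h3 hpr
    (fun x => hst x)
  rw [proposalLaw, h5]

theorem map_swap_proposalLaw_withDensity {πs : Measure Y} [IsProbabilityMeasure πs]
    {R : Kernel Y U} [IsMarkovKernel R] {S : Kernel (Y × U) Y} [IsMarkovKernel S]
    {T : Kernel ((Y × U) × Y) U} [IsMarkovKernel T] {α : (Y × U) × (Y × U) → ℝ≥0∞}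
    (hα : Measurable α) (hacc : IsAcceptanceProbability πs R S T α) :
    ((proposalLaw πs R S T).withDensity α).map Prod.swap
      = (proposalLaw πs R S T).withDensity α := by
  have : IsProbabilityMeasure (proposalLaw πs R S T) := by unfold proposalLaw; infer_instance
  rcases hacc.2 with ⟨lY, lU, p, r, s, t, _, _, hp, hr, hs, ht, hπ, hR, hS, hT, h⟩ | h
  · refine map_swap_withDensity_of_acceptance Measure.prod_swap ?_
      (proposalLaw_eq_withDensity hp hr hs ht hπ hR hS hT) hα ?_
    · exact measurable_density hp hr hs ht
    filter_upwards [h] with z hz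
    rw [hz z.1.1 z.1.2 z.2.1 z.2.2 rfl]
    simp [mul_assoc]
  · set μ := proposalLaw πs R S T
    have hsw : (μ.map Prod.swap).map Prod.swap = μ := by
      rw [Measure.map_map measurable_swap measurable_swap]
      simp
    have : IsProbabilityMeasure (μ.map Prod.swap) :=
      Measure.isProbabilityMeasure_map measurable_swap.aemeasurable
    -- This dominates μ and its swap image ν and is swap-invariant. With F = dμ/dm one has dν/dm =
    -- F∘swap, and dν/dμ is their quotient μ-a.e. even when ν is not absolutely continuous with
    -- respect to μ.
    set m := μ + μ.map Prod.swap
    have hm : m.map Prod.swap = m := by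
      rw [Measure.map_add _ _ measurable_swap, hsw, add_comm]
    have hac : μ ≪ m := Measure.le_add_right le_rfl |>.absolutelyContinuous
    have hac' : μ.map Prod.swap ≪ m := Measure.le_add_left le_rfl |>.absolutelyContinuous
    have hμ : μ = m.withDensity (μ.rnDeriv m) := (Measure.withDensity_rnDeriv_eq _ _ hac).symm
    have hν : (μ.map Prod.swap).rnDeriv m =ᵐ[m] fun z => μ.rnDeriv m z.swap := by
      have h1 : (fun z => (μ.map Prod.swap).rnDeriv (m.map Prod.swap) z.swap)
          =ᵐ[m] μ.rnDeriv m :=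
        MeasurableEquiv.prodComm.measurableEmbedding.rnDeriv_map μ m
      rw [hm] at h1
      have hmp : MeasurePreserving (Prod.swap : (Y × U) × (Y × U) → _) m m := ⟨measurable_swap, hm⟩
      filter_upwards [hmp.quasiMeasurePreserving.ae h1] with z hz
      simpa using hz
    refine map_swap_withDensity_of_acceptance hm (Measure.measurable_rnDeriv _ _) hμ hα ?_
    filter_upwards [h, Measure.rnDeriv_eq_div hac' hac, hac hν] with z h1 h2 h3
    rw [h1, h2, h3]

theorem isMarkovKernel_acceptReject {X : Type*} [MeasurableSpace X] {α : X × X → ℝ≥0∞}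
    (hα : Measurable α) (h : ∀ z, α z ≤ 1) : IsMarkovKernel (acceptReject α hα) := by
  refine ⟨fun z => ⟨?_⟩⟩
  have := lintegral_acceptReject α hα z (f := 1) measurable_one
  simpa [h z] using this

/-- The flow from A to B splits into accepted moves, symmetric by the swap invariance of α·μ, and
rejections, which stay put and so contribute only on A ∩ B. -/
theorem isReversible_freezeKernel {πs : Measure Y} [IsProbabilityMeasure πs]
    {R : Kernel Y U} [IsMarkovKernel R] {S : Kernel (Y × U) Y} [IsMarkovKernel S]
    {T : Kernel ((Y × U) × Y) U} [IsMarkovKernel T] {α : (Y × U) × (Y × U) → ℝ≥0∞}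
    (hα : Measurable α) (hacc : IsAcceptanceProbability πs R S T α) :
    (freezeKernel S T α hα).IsReversible (πs ⊗ₘ R) := by
  set μ := proposalLaw πs R S T with hμ
  have key : ∀ A B : Set (Y × U), MeasurableSet A → MeasurableSet B →
      ∫⁻ x in A, freezeKernel S T α hα x B ∂(πs ⊗ₘ R)
        = (μ.withDensity α) (A ×ˢ B) + ∫⁻ z, (A ∩ B).indicator 1 z.1 * (1 - α z) ∂μ := by
    intro A B hA hB
    have hBm : Measurable (B.indicator (1 : Y × U → ℝ≥0∞)) := measurable_one.indicator hB
    have hAm : Measurable (A.indicator (1 : Y × U → ℝ≥0∞)) := measurable_one.indicator hA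
    have hg : Measurable fun z : (Y × U) × (Y × U) =>
        α z * B.indicator 1 z.2 + (1 - α z) * B.indicator 1 z.1 := by fun_prop
    have e : ∀ x, freezeKernel S T α hα x B
        = ∫⁻ b, (α (x, b) * B.indicator 1 b + (1 - α (x, b)) * B.indicator 1 x)
          ∂((S ⊗ₖ T) x) := by
      intro x
      rw [← lintegral_indicator_one hB, freezeKernel, Kernel.lintegral_comp _ _ _ hBm]
      simp_rw [lintegral_acceptReject α hα _ hBm]
      rw [Kernel.lintegral_id_prod hg]
    have e2 : ∫⁻ x in A, freezeKernel S T α hα x B ∂(πs ⊗ₘ R)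
        = ∫⁻ z, A.indicator 1 z.1 * (α z * B.indicator 1 z.2 + (1 - α z) * B.indicator 1 z.1)
          ∂μ := by
      rw [hμ, proposalLaw, Measure.lintegral_compProd (by fun_prop), ← lintegral_indicator hA]
      refine lintegral_congr fun x => ?_
      rw [lintegral_const_mul (A.indicator 1 x)
        (f := fun b => α (x, b) * B.indicator 1 b + (1 - α (x, b)) * B.indicator 1 x)
        (hg.comp measurable_prodMk_left), ← e]
      by_cases hx : x ∈ A <;> simp [hx]
    rw [e2, withDensity_apply _ (hA.prod hB), ← lintegral_indicator (hA.prod hB),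
      ← lintegral_add_left (hα.indicator (hA.prod hB))]
    refine lintegral_congr fun z => ?_
    by_cases h1 : z.1 ∈ A <;> by_cases h2 : z.2 ∈ B <;> by_cases h3 : z.1 ∈ B <;>
      simp [h1, h2, h3, Set.indicator]
  intro A B hA hB
  rw [key A B hA hB, key B A hB hA, Set.inter_comm]
  congr 1
  -- Swapping the accepted flow turns A × B into B × A.
  rw [← map_swap_proposalLaw_withDensity hα hacc, Measure.map_apply measurable_swap (hA.prod hB),
    Set.preimage_swap_prod, map_swap_proposalLaw_withDensity hα hacc]

end Reversibility

/-! ### Couplings and transition kernels as operators on L² -/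

section Operators

variable {Ω E F : Type*} [MeasurableSpace Ω] [MeasurableSpace E] [MeasurableSpace F]

/-- The indicator of a measurable set as an element of `L²`. -/
noncomputable def indicatorL2 (m : Measure E) [IsFiniteMeasure m] {A : Set E}
    (hA : MeasurableSet A) : Lp ℝ 2 m :=
  indicatorConstLp 2 hA (measure_ne_top m A) 1

theorem inner_indicatorL2 {m : Measure E} [IsFiniteMeasure m] {A : Set E} (hA : MeasurableSet A)
    (f : Lp ℝ 2 m) : inner ℝ (indicatorL2 m hA) f = ∫ x in A, f x ∂m :=
  L2.inner_indicatorConstLp_one hA _ f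

/-- A closed linear condition on `L²` holds everywhere once it holds for indicators. -/
theorem eq_of_eq_on_indicatorL2 {G : Type*} [NormedAddCommGroup G] [NormedSpace ℝ G]
    {m : Measure E} [IsFiniteMeasure m] {S T : Lp ℝ 2 m →L[ℝ] G}
    (h : ∀ (A : Set E) (hA : MeasurableSet A), S (indicatorL2 m hA) = T (indicatorL2 m hA)) :
    S = T := by
  ext f
  induction f using Lp.induction (p := 2) ENNReal.ofNat_ne_top with
  | indicatorConst c hs hμs =>
    have e : ((Lp.simpleFunc.indicatorConst 2 hs hμs.ne c : Lp.simpleFunc ℝ 2 m) : Lp ℝ 2 m)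
        = c • indicatorL2 m hs := by
      rw [Lp.simpleFunc.coe_indicatorConst, indicatorL2,
        indicatorConstLp_eq_toSpanSingleton_compLp]
      ext1
      filter_upwards [Lp.coeFn_smul c (indicatorConstLp 2 hs hμs.ne (1 : ℝ)),
        ContinuousLinearMap.coeFn_compLp (ContinuousLinearMap.toSpanSingleton ℝ c)
          (indicatorConstLp 2 hs hμs.ne (1 : ℝ))] with x h1 h2
      rw [h1, h2]
      simp [mul_comm]
    rw [e, map_smul, map_smul, h]
  | add hf hg _ h1 h2 => rw [map_add, map_add, h1, h2]
  | isClosed => exact isClosed_eq S.continuous T.continuous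

theorem eq_of_inner_indicatorL2_eq {m : Measure E} [IsFiniteMeasure m] {f g : Lp ℝ 2 m}
    (h : ∀ (A : Set E) (hA : MeasurableSet A),
      inner ℝ (indicatorL2 m hA) f = inner ℝ (indicatorL2 m hA) g) : f = g := by
  refine ext_inner_left ℝ fun v => ?_
  have : innerSL ℝ f = innerSL ℝ g := eq_of_eq_on_indicatorL2 fun A hA => by
    simpa only [innerSL_apply_apply, real_inner_comm] using h A hA
  have := congrArg (fun L => L v) this
  simpa only [innerSL_apply_apply, real_inner_comm] using this

/-- Reduces operator identities to identities between measures of rectangles, where kernels can be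
evaluated directly. -/
theorem operator_ext_indicatorL2 {m : Measure E} [IsFiniteMeasure m] {m' : Measure F}
    [IsFiniteMeasure m'] {S T : Lp ℝ 2 m' →L[ℝ] Lp ℝ 2 m}
    (h : ∀ (A : Set F) (hA : MeasurableSet A) (B : Set E) (hB : MeasurableSet B),
      inner ℝ (indicatorL2 m hB) (S (indicatorL2 m' hA))
        = inner ℝ (indicatorL2 m hB) (T (indicatorL2 m' hA))) : S = T :=
  eq_of_eq_on_indicatorL2 fun A hA => eq_of_inner_indicatorL2_eq fun B hB => h A hA B hB

/-- Composition with a measure-preserving map, as an operator between `L²` spaces. -/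
noncomputable def compL2 {P : Measure Ω} {m : Measure E} {X : Ω → E}
    (hX : MeasurePreserving X P m) : Lp ℝ 2 m →L[ℝ] Lp ℝ 2 P :=
  (Lp.compMeasurePreservingₗᵢ ℝ X hX).toContinuousLinearMap

theorem inner_compL2_compL2 {P : Measure Ω} {m : Measure E} {X : Ω → E}
    (hX : MeasurePreserving X P m) (f g : Lp ℝ 2 m) :
    inner ℝ (compL2 hX f) (compL2 hX g) = inner ℝ f g :=
  (Lp.compMeasurePreservingₗᵢ ℝ X hX).inner_map_map f g

theorem norm_compL2_le {P : Measure Ω} {m : Measure E} {X : Ω → E}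
    (hX : MeasurePreserving X P m) : ‖compL2 hX‖ ≤ 1 :=
  ContinuousLinearMap.opNorm_le_bound _ zero_le_one fun f => by
    rw [one_mul]
    exact (Lp.norm_compMeasurePreserving f hX).le

theorem coeFn_compL2 {P : Measure Ω} {m : Measure E} {X : Ω → E}
    (hX : MeasurePreserving X P m) (f : Lp ℝ 2 m) : compL2 hX f =ᵐ[P] fun ω => f (X ω) :=
  Lp.coeFn_compMeasurePreserving f hX

theorem compL2_toLp {P : Measure Ω} {m : Measure E} {X : Ω → E}
    (hX : MeasurePreserving X P m) {f : E → ℝ} (hf : MemLp f 2 m) :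
    compL2 hX (hf.toLp f) = (hf.comp_measurePreserving hX).toLp (f ∘ X) :=
  Lp.toLp_compMeasurePreserving hf hX

theorem compL2_indicatorL2 {P : Measure Ω} [IsFiniteMeasure P] {m : Measure E} [IsFiniteMeasure m]
    {X : Ω → E} (hX : MeasurePreserving X P m) {A : Set E} (hA : MeasurableSet A) :
    compL2 hX (indicatorL2 m hA) = indicatorL2 P (hX.measurable hA) :=
  rfl

theorem inner_indicatorL2_indicatorL2 {m : Measure E} [IsFiniteMeasure m] {A B : Set E}
    (hA : MeasurableSet A) (hB : MeasurableSet B) :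
    inner ℝ (indicatorL2 m hA) (indicatorL2 m hB) = m.real (A ∩ B) := by
  rw [indicatorL2, indicatorL2, L2.inner_indicatorConstLp_indicatorConstLp hA hB]
  simp

/-- The operator `f ↦ E[f(Y) | X]` from `L²` of the law of `Y` to `L²` of the law of `X`. -/
noncomputable def couplingOperator {P : Measure Ω} {m : Measure E} {m' : Measure F} {X : Ω → E}
    {Y : Ω → F} (hX : MeasurePreserving X P m) (hY : MeasurePreserving Y P m') :
    Lp ℝ 2 m' →L[ℝ] Lp ℝ 2 m :=
  (compL2 hX).adjoint ∘L compL2 hY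

theorem inner_couplingOperator {P : Measure Ω} {m : Measure E} {m' : Measure F} {X : Ω → E}
    {Y : Ω → F} (hX : MeasurePreserving X P m) (hY : MeasurePreserving Y P m') (f : Lp ℝ 2 m)
    (g : Lp ℝ 2 m') :
    inner ℝ f (couplingOperator hX hY g) = inner ℝ (compL2 hX f) (compL2 hY g) := by
  rw [couplingOperator, ContinuousLinearMap.comp_apply, ContinuousLinearMap.adjoint_inner_right]

theorem norm_couplingOperator_le {P : Measure Ω} {m : Measure E} {m' : Measure F} {X : Ω → E}
    {Y : Ω → F} (hX : MeasurePreserving X P m) (hY : MeasurePreserving Y P m') :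
    ‖couplingOperator hX hY‖ ≤ 1 := by
  refine (ContinuousLinearMap.opNorm_comp_le _ _).trans ?_
  rw [LinearIsometryEquiv.norm_map]
  exact mul_le_one₀ (norm_compL2_le hX) (norm_nonneg _) (norm_compL2_le hY)

theorem inner_indicatorL2_couplingOperator {P : Measure Ω} [IsFiniteMeasure P] {m : Measure E}
    [IsFiniteMeasure m] {m' : Measure F} [IsFiniteMeasure m'] {X : Ω → E}
    {Y : Ω → F} (hX : MeasurePreserving X P m) (hY : MeasurePreserving Y P m') {A : Set F}
    (hA : MeasurableSet A) {B : Set E} (hB : MeasurableSet B) :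
    inner ℝ (indicatorL2 m hB) (couplingOperator hX hY (indicatorL2 m' hA))
      = P.real (X ⁻¹' B ∩ Y ⁻¹' A) := by
  rw [inner_couplingOperator, compL2_indicatorL2, compL2_indicatorL2,
    inner_indicatorL2_indicatorL2]

theorem measurePreserving_fst_compProd (m : Measure E) [SFinite m] (K : Kernel E F)
    [IsMarkovKernel K] : MeasurePreserving Prod.fst (m ⊗ₘ K) m :=
  ⟨measurable_fst, Measure.fst_compProd m K⟩

theorem measurePreserving_snd_compProd {m : Measure E} [SFinite m] {K : Kernel E E}
    [IsMarkovKernel K] (hK : K.Invariant m) : MeasurePreserving Prod.snd (m ⊗ₘ K) m :=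
  ⟨measurable_snd, (Measure.snd_compProd m K).trans hK⟩

/-- The operator `f ↦ (x ↦ ∫ f dK(x, ·))` on `L²` of an invariant measure. -/
noncomputable def transitionOperator {m : Measure E} [IsProbabilityMeasure m] {K : Kernel E E}
    [IsMarkovKernel K] (hK : K.Invariant m) : Lp ℝ 2 m →L[ℝ] Lp ℝ 2 m :=
  couplingOperator (measurePreserving_fst_compProd m K) (measurePreserving_snd_compProd hK)

variable {m : Measure E} [IsProbabilityMeasure m] {K : Kernel E E} [IsMarkovKernel K]

theorem real_compProd_prod {A B : Set E} (hA : MeasurableSet A) (hB : MeasurableSet B) :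
    (m ⊗ₘ K).real (B ×ˢ A) = ∫ x in B, (K x).real A ∂m := by
  rw [measureReal_def, Measure.compProd_apply_prod hB hA, integral_eq_lintegral_of_nonneg_ae
    (ae_of_all _ fun _ => measureReal_nonneg)
    (K.measurable_coe hA).ennreal_toReal.aestronglyMeasurable]
  simp

theorem inner_indicatorL2_transitionOperator (hK : K.Invariant m) {A B : Set E}
    (hA : MeasurableSet A) (hB : MeasurableSet B) :
    inner ℝ (indicatorL2 m hB) (transitionOperator hK (indicatorL2 m hA))
      = ∫ x in B, (K x).real A ∂m := by
  rw [transitionOperator, inner_indicatorL2_couplingOperator, ← real_compProd_prod hA hB]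
  rfl

theorem transitionOperator_indicatorL2_ae_eq (hK : K.Invariant m) {A : Set E}
    (hA : MeasurableSet A) :
    transitionOperator hK (indicatorL2 m hA) =ᵐ[m] fun x => (K x).real A := by
  have hm : MemLp (fun x => (K x).real A) 2 m :=
    MemLp.of_bound (K.measurable_coe hA).ennreal_toReal.aestronglyMeasurable 1
      (ae_of_all _ fun x => by
        rw [Real.norm_of_nonneg measureReal_nonneg]
        exact measureReal_le_one)
  have e : transitionOperator hK (indicatorL2 m hA) = hm.toLp _ :=
    eq_of_inner_indicatorL2_eq fun B hB => by
      rw [inner_indicatorL2_transitionOperator hK hA hB, inner_indicatorL2]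
      exact integral_congr_ae (ae_restrict_of_ae hm.coeFn_toLp.symm)
  rw [e]
  exact hm.coeFn_toLp

/-- On indicators the two sides are the masses of A × B and B × A under `m ⊗ₘ K`, which detailed
balance equates. -/
theorem inner_transitionOperator_of_isReversible (hK : K.Invariant m) (hrev : K.IsReversible m)
    (f g : Lp ℝ 2 m) :
    inner ℝ (transitionOperator hK f) g = inner ℝ f (transitionOperator hK g) := by
  rw [← ContinuousLinearMap.adjoint_inner_right]
  congr 2
  refine operator_ext_indicatorL2 fun A hA B hB => ?_
  rw [ContinuousLinearMap.adjoint_inner_right, real_inner_comm,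
    inner_indicatorL2_transitionOperator hK hB hA, inner_indicatorL2_transitionOperator hK hA hB,
    ← real_compProd_prod hA hB, ← real_compProd_prod hB hA, measureReal_def, measureReal_def,
    Measure.compProd_apply_prod hB hA, Measure.compProd_apply_prod hA hB, hrev hA hB]

end Operators

/-! ### Stationary Markov chains and their autocovariances -/

section MarkovChains

variable {Ω E : Type*} [MeasurableSpace Ω] [MeasurableSpace E]
  {m : Measure E} {K : Kernel E E} {P : Measure Ω} [IsProbabilityMeasure P] {Z : ℕ → Ω → E}

/-- Since j ≤ k, the event on `Z j` belongs to the past at time k, so the conditional probability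
may be integrated over it. -/
theorem IsMarkovChain.measureReal_inter (hZ : IsMarkovChain P m K Z) {j k : ℕ} (hjk : j ≤ k)
    {A B : Set E} (hA : MeasurableSet A) (hB : MeasurableSet B) :
    P.real (Z j ⁻¹' B ∩ Z (k + 1) ⁻¹' A) = ∫ ω in Z j ⁻¹' B, (K (Z k ω)).real A ∂P := by
  have hle : pastSigma Z k ≤ ‹MeasurableSpace Ω› :=
    iSup₂_le fun i _ => (hZ.measurable i).comap_le
  have hB' : MeasurableSet[pastSigma Z k] (Z j ⁻¹' B) :=
    le_iSup₂ (f := fun i (_ : i ∈ Set.Iic k) => MeasurableSpace.comap (Z i) inferInstance) j hjk _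
      ⟨B, hB, rfl⟩
  have hA' : MeasurableSet (Z (k + 1) ⁻¹' A) := hZ.measurable _ hA
  rw [← setIntegral_congr_ae (hle _ hB') ((hZ.transition k A hA).mono fun _ h _ => h),
    setIntegral_condExp hle ((integrable_const 1).indicator hA') hB',
    setIntegral_indicator hA']
  simp

variable [IsProbabilityMeasure m] [IsMarkovKernel K]

theorem IsMarkovChain.measurePreserving (hZ : IsMarkovChain P m K Z) (hK : K.Invariant m) (k : ℕ) :
    MeasurePreserving (Z k) P m := by
  induction k with
  | zero => exact ⟨hZ.measurable 0, hZ.initial⟩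
  | succ k ih =>
    refine ⟨hZ.measurable _, ?_⟩
    refine Measure.ext fun A hA => ?_
    rw [Measure.map_apply (hZ.measurable _) hA,
      ← ENNReal.toReal_eq_toReal_iff' (measure_ne_top _ _) (measure_ne_top _ _)]
    have e1 := hZ.measureReal_inter (le_refl k) hA MeasurableSet.univ
    have e2 : ∫ ω, (K (Z k ω)).real A ∂P = ∫ x, (K x).real A ∂m := by
      rw [← ih.map_eq, integral_map (f := fun x => (K x).real A) ih.aemeasurable
        (K.measurable_coe hA).ennreal_toReal.aestronglyMeasurable]
    have e3 := real_compProd_prod (m := m) (K := K) hA MeasurableSet.univ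
    have e4 := (measurePreserving_snd_compProd hK).measure_preimage hA.nullMeasurableSet
    rw [Set.preimage_univ, Set.univ_inter, setIntegral_univ, e2] at e1
    rw [setIntegral_univ, Set.univ_prod] at e3
    rw [← measureReal_def, e1, ← e3, measureReal_def, e4]

/-- E[f(Z_j) g(Z_{j+k})] = ⟨f, Pᵏ g⟩: the Markov property peels off the last step, replacing g by
Pg, so g must vary in the induction. -/
theorem IsMarkovChain.inner_compL2 (hZ : IsMarkovChain P m K Z) (hK : K.Invariant m) (j k : ℕ)
    (f g : Lp ℝ 2 m) :
    inner ℝ (compL2 (hZ.measurePreserving hK j) f) (compL2 (hZ.measurePreserving hK (j + k)) g)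
      = inner ℝ f ((transitionOperator hK ^ k) g) := by
  induction k generalizing g with
  | zero => exact inner_compL2_compL2 _ _ _
  | succ k ih =>
    rw [pow_succ, mul_apply_eq_comp, ← ih, ← inner_couplingOperator, ← inner_couplingOperator]
    have : couplingOperator (hZ.measurePreserving hK j) (hZ.measurePreserving hK (j + (k + 1)))
        = couplingOperator (hZ.measurePreserving hK j) (hZ.measurePreserving hK (j + k))
          ∘L transitionOperator hK := by
      refine operator_ext_indicatorL2 fun A hA B hB => ?_
      rw [inner_indicatorL2_couplingOperator, ← add_assoc,
        hZ.measureReal_inter (Nat.le_add_right j k) hA hB, ContinuousLinearMap.comp_apply,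
        inner_couplingOperator, compL2_indicatorL2, inner_indicatorL2]
      refine integral_congr_ae (ae_restrict_of_ae ?_)
      filter_upwards [coeFn_compL2 (hZ.measurePreserving hK (j + k))
        (transitionOperator hK (indicatorL2 m hA)),
        (hZ.measurePreserving hK (j + k)).quasiMeasurePreserving.ae
          (transitionOperator_indicatorL2_ae_eq hK hA)] with ω h1 h2
      rw [h1, h2]
    rw [this]
    rfl

theorem memLp_sub_integral {h : E → ℝ} (hh : MemLp h 2 m) :
    MemLp (fun x => h x - ∫ y, h y ∂m) 2 m :=
  hh.sub (memLp_const _)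

theorem IsMarkovChain.covariance_eq (hZ : IsMarkovChain P m K Z) (hK : K.Invariant m) {h : E → ℝ}
    (hh : MemLp h 2 m) (j k : ℕ) :
    cov[fun ω => h (Z j ω), fun ω => h (Z (j + k) ω); P]
      = inner ℝ ((memLp_sub_integral hh).toLp _)
        ((transitionOperator hK ^ k) ((memLp_sub_integral hh).toLp _)) := by
  have hint : ∀ i, ∫ ω, h (Z i ω) ∂P = ∫ x, h x ∂m := fun i => by
    rw [← (hZ.measurePreserving hK i).map_eq, integral_map (hZ.measurable i).aemeasurable]
    rw [(hZ.measurePreserving hK i).map_eq]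
    exact hh.aestronglyMeasurable
  rw [← hZ.inner_compL2 hK j k, compL2_toLp, compL2_toLp, L2.inner_def, covariance, hint, hint]
  refine integral_congr_ae ?_
  filter_upwards [((memLp_sub_integral hh).comp_measurePreserving
      (hZ.measurePreserving hK j)).coeFn_toLp, ((memLp_sub_integral hh).comp_measurePreserving
      (hZ.measurePreserving hK (j + k))).coeFn_toLp] with ω h1 h2
  rw [h1, h2]
  simp [mul_comm]

theorem IsMarkovChain.tendsto_variance (hZ : IsMarkovChain P m K Z) (hK : K.Invariant m)
    {h : E → ℝ} (hh : MemLp h 2 m)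
    (hs : Summable fun k : ℕ => |cov[fun ω => h (Z 0 ω), fun ω => h (Z (k + 1) ω); P]|) :
    (Summable fun k : ℕ => inner ℝ ((memLp_sub_integral hh).toLp _)
        ((transitionOperator hK ^ k) ((memLp_sub_integral hh).toLp _))) ∧
    Tendsto (fun n : ℕ => (1 / (n : ℝ)) * Var[fun ω => ∑ k ∈ Finset.range n, h (Z k ω); P]) atTop
      (𝓝 (2 * ∑' k : ℕ, inner ℝ ((memLp_sub_integral hh).toLp _)
        ((transitionOperator hK ^ k) ((memLp_sub_integral hh).toLp _))
        - inner ℝ ((memLp_sub_integral hh).toLp _) ((memLp_sub_integral hh).toLp _))) := by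
  have hs' : Summable fun k : ℕ => inner ℝ ((memLp_sub_integral hh).toLp _)
        ((transitionOperator hK ^ k) ((memLp_sub_integral hh).toLp _)) := by
    -- The hypothesis covers lags from 1 on; adding lag 0 does not affect summability.
    refine (summable_nat_add_iff 1).1 (hs.of_abs.congr fun k => ?_)
    rw [← hZ.covariance_eq hK hh 0 (k + 1), zero_add]
  exact ⟨hs', tendsto_variance_sum_div
    (fun k => hh.comp_measurePreserving (hZ.measurePreserving hK k))
    (fun j k => hZ.covariance_eq hK hh j k) hs'⟩

end MarkovChains

/-! ### The refreshment operator as a compression -/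

section Refreshment

variable {Y U : Type*} [MeasurableSpace Y] [MeasurableSpace U]

theorem refreshKernel_eq_freezeKernel {R : Kernel Y U} {S : Kernel (Y × U) Y}
    {T : Kernel ((Y × U) × Y) U} {α : (Y × U) × (Y × U) → ℝ≥0∞} {hα : Measurable α} :
    refreshKernel R S T α hα = ((freezeKernel S T α hα).map Prod.fst) ∘ₖ (Kernel.id ×ₖ R) := by
  rw [refreshKernel, freezeKernel, Kernel.map_comp]

variable {πs : Measure Y} [IsProbabilityMeasure πs] {R : Kernel Y U} [IsMarkovKernel R]
  {S : Kernel (Y × U) Y} {T : Kernel ((Y × U) × Y) U} {α : (Y × U) × (Y × U) → ℝ≥0∞}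
  {hα : Measurable α}

/-- With u drawn from R, a start from π* is a start from π, so the refreshment flow between sets is
the freeze flow between their cylinders. Invariance and Q = J* P J both follow from this. -/
theorem setLIntegral_refreshKernel {A B : Set Y} (hA : MeasurableSet A) (hB : MeasurableSet B) :
    ∫⁻ y in B, refreshKernel R S T α hα y A ∂πs
      = ∫⁻ x in Prod.fst ⁻¹' B, freezeKernel S T α hα x (Prod.fst ⁻¹' A) ∂(πs ⊗ₘ R) := by
  have hm : Measurable fun x => freezeKernel S T α hα x (Prod.fst ⁻¹' A) :=
    Kernel.measurable_coe _ (measurable_fst hA)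
  rw [← lintegral_indicator (measurable_fst hB),
    Measure.lintegral_compProd (hm.indicator (measurable_fst hB)), ← lintegral_indicator hB]
  refine lintegral_congr fun y => ?_
  by_cases hy : y ∈ B
  · simp only [Set.indicator, Set.mem_preimage, hy, if_true]
    rw [refreshKernel_eq_freezeKernel, Kernel.comp_apply' _ _ _ hA]
    simp_rw [Kernel.map_apply' _ measurable_fst _ hA]
    rw [Kernel.lintegral_id_prod hm]
  · simp [Set.indicator, hy]

theorem invariant_refreshKernel (h : (freezeKernel S T α hα).Invariant (πs ⊗ₘ R)) :
    (refreshKernel R S T α hα).Invariant πs := by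
  refine Measure.ext fun A hA => ?_
  rw [Measure.bind_apply hA (Kernel.aemeasurable _), ← setLIntegral_univ,
    setLIntegral_refreshKernel hA .univ, Set.preimage_univ, setLIntegral_univ,
    ← Measure.bind_apply (measurable_fst hA) (Kernel.aemeasurable _), h.def,
    ← (measurePreserving_fst_compProd πs R).measure_preimage hA.nullMeasurableSet]

theorem inner_transitionOperator_refreshKernel [IsMarkovKernel (freezeKernel S T α hα)]
    [IsMarkovKernel (refreshKernel R S T α hα)]
    (hP : (freezeKernel S T α hα).Invariant (πs ⊗ₘ R))
    (hQ : (refreshKernel R S T α hα).Invariant πs) (f g : Lp ℝ 2 πs) :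
    inner ℝ f (transitionOperator hQ g)
      = inner ℝ (compL2 (measurePreserving_fst_compProd πs R) f)
        (transitionOperator hP (compL2 (measurePreserving_fst_compProd πs R) g)) := by
  set J := compL2 (measurePreserving_fst_compProd πs R)
  have : transitionOperator hQ = J.adjoint ∘L transitionOperator hP ∘L J := by
    refine operator_ext_indicatorL2 fun A hA B hB => ?_
    simp only [ContinuousLinearMap.comp_apply]
    rw [ContinuousLinearMap.adjoint_inner_right, compL2_indicatorL2, compL2_indicatorL2,
      inner_indicatorL2_transitionOperator, inner_indicatorL2_transitionOperator hP
        (measurable_fst hA) (measurable_fst hB), ← real_compProd_prod hA hB,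
      ← real_compProd_prod (measurable_fst hA) (measurable_fst hB), measureReal_def,
      measureReal_def, Measure.compProd_apply_prod hB hA,
      Measure.compProd_apply_prod (measurable_fst hB) (measurable_fst hA),
      setLIntegral_refreshKernel hA hB]
  rw [this, ContinuousLinearMap.comp_apply, ContinuousLinearMap.adjoint_inner_right]
  rfl

variable [IsMarkovKernel S] [IsMarkovKernel T]

theorem isMarkovKernel_freezeKernel (h : ∀ z, α z ≤ 1) : IsMarkovKernel (freezeKernel S T α hα) := by
  have := isMarkovKernel_acceptReject hα h
  unfold freezeKernel
  infer_instance

theorem isMarkovKernel_refreshKernel (h : ∀ z, α z ≤ 1) :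
    IsMarkovKernel (refreshKernel R S T α hα) := by
  have := isMarkovKernel_freezeKernel (S := S) (T := T) (hα := hα) h
  have := Kernel.IsMarkovKernel.map (freezeKernel S T α hα) (measurable_fst (α := Y) (β := U))
  rw [refreshKernel_eq_freezeKernel]
  infer_instance

end Refreshment

end DataAugmentation

/-! ### Comparison of the two algorithms -/

theorem mainTheorem3
    {Y U Ω₁ Ω₂ : Type*} [MeasurableSpace Y] [MeasurableSpace U]
    [MeasurableSpace Ω₁] [MeasurableSpace Ω₂]
    (P₁ : Measure Ω₁) [IsProbabilityMeasure P₁] (P₂ : Measure Ω₂) [IsProbabilityMeasure P₂]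
    (πs : Measure Y) [IsProbabilityMeasure πs]
    (R : Kernel Y U) [IsMarkovKernel R]
    (S : Kernel (Y × U) Y) [IsMarkovKernel S]
    (T : Kernel ((Y × U) × Y) U) [IsMarkovKernel T]
    (α : (Y × U) × (Y × U) → ℝ≥0∞) (hα : Measurable α)
    (hacc : DataAugmentation.IsAcceptanceProbability πs R S T α)
    (Y₁ : ℕ → Ω₁ → Y) (U₁ : ℕ → Ω₁ → U) (Y₂ : ℕ → Ω₂ → Y)
    (h₁ : DataAugmentation.IsMarkovChain P₁ (πs ⊗ₘ R)
      (DataAugmentation.freezeKernel S T α hα) (fun k ω => (Y₁ k ω, U₁ k ω)))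
    (h₂ : DataAugmentation.IsMarkovChain P₂ πs
      (DataAugmentation.refreshKernel R S T α hα) Y₂)
    (h : Y → ℝ) (hh : MemLp h 2 πs)
    (hsum₁ : Summable fun k : ℕ =>
      |cov[fun ω => h (Y₁ 0 ω), fun ω => h (Y₁ (k + 1) ω); P₁]|)
    (hsum₂ : Summable fun k : ℕ =>
      |cov[fun ω => h (Y₂ 0 ω), fun ω => h (Y₂ (k + 1) ω); P₂]|) :
    ∃ v₁ v₂ : ℝ,
      Tendsto (fun n : ℕ => (1 / (n : ℝ)) *
        Var[fun ω => ∑ k ∈ Finset.range n, h (Y₁ k ω); P₁]) atTop (𝓝 v₁) ∧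
      Tendsto (fun n : ℕ => (1 / (n : ℝ)) *
        Var[fun ω => ∑ k ∈ Finset.range n, h (Y₂ k ω); P₂]) atTop (𝓝 v₂) ∧
      v₂ ≤ v₁ := by
  obtain ⟨hle, -⟩ := id hacc
  have := DataAugmentation.isMarkovKernel_freezeKernel (S := S) (T := T) (hα := hα) hle
  have := DataAugmentation.isMarkovKernel_refreshKernel (R := R) (S := S) (T := T) (hα := hα) hle
  have hrev := DataAugmentation.isReversible_freezeKernel hα hacc
  have hP := hrev.invariant
  have hQ := DataAugmentation.invariant_refreshKernel hP
  have hfst := DataAugmentation.measurePreserving_fst_compProd πs R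
  have hh' : MemLp (fun x : Y × U => h x.1) 2 (πs ⊗ₘ R) := hh.comp_measurePreserving hfst
  obtain ⟨s₁, t₁⟩ := h₁.tendsto_variance hP hh' hsum₁
  obtain ⟨s₂, t₂⟩ := h₂.tendsto_variance hQ hh hsum₂
  refine ⟨_, _, t₁, t₂, ?_⟩
  have hint : ∫ x, h x.1 ∂(πs ⊗ₘ R) = ∫ y, h y ∂πs := by
    conv_rhs => rw [← hfst.map_eq]
    rw [integral_map hfst.aemeasurable (by rw [hfst.map_eq]; exact hh.aestronglyMeasurable)]
  -- Centring commutes with J because h has the same mean under π* and π.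
  have hJ : (DataAugmentation.memLp_sub_integral hh').toLp _ = DataAugmentation.compL2 hfst
      ((DataAugmentation.memLp_sub_integral hh).toLp _) := by
    rw [DataAugmentation.compL2_toLp]
    congr 1
    ext x
    simp [hint]
  rw [hJ] at s₁ ⊢
  rw [DataAugmentation.inner_compL2_compL2]
  have := DataAugmentation.tsum_autocovariance_compression_le
    (P := DataAugmentation.transitionOperator hP) (Q := DataAugmentation.transitionOperator hQ)
    (DataAugmentation.compL2 hfst)
    (DataAugmentation.inner_compL2_compL2 hfst)
    (DataAugmentation.norm_couplingOperator_le _ _) (DataAugmentation.norm_couplingOperator_le _ _)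
    (DataAugmentation.inner_transitionOperator_of_isReversible hP hrev)
    (DataAugmentation.inner_transitionOperator_refreshKernel hP hQ) _ s₂ s₁
  linarith
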